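/- A convex subset $Q$ of a (real, Hausdorff) topological vector space is called *locally nonconical* (LNC) if for all $x, x' \in Q$ and every net $(x_t)$ in $Q$ converging to $x$, the points $x_t + (x'-x)/2$ eventually lie in $Q$; equivalently, for all $x, x' \in Q$ there is a relative neighborhood $U$ of $x$ in $Q$ with $U + (x'-x)/2 \subset Q$. Let $F$ be a finite-dimensional real Hausdorff topological vector space (i.e. $F \cong \mathbf{R}^m$). (1) Every zonoid in $F$ is LNC (in particular convex). That is, let $\nu$ be a countably additive $F$-valued measure on a $\sigma$-algebra $\Sigma$ which is nonatomic: there is no $A \in \Sigma$ with $\nu(A) \neq 0$ such that $\nu(B) \in \{0, \nu(A)\}$ for all $B \in \Sigma$ with $B \subset A$. Then the range $\{\nu(A) : A \in \Sigma\}$ is LNC. (2) More generally, let $K$ be a compact, strictly convex subset of $\mathbf{R}^n$ (for any two distinct points of $K$, the open segment between them lies in the interior of $K$), let $(\Omega, \mu)$ be a $\sigma$-finite measure space, and let $Q = L^\infty(\Omega; K)$ be the set of those $f \in L^\infty(\Omega; \mathbf{R}^n)$ with $f(\omega) \in K$ for almost every $\omega$. Let $T : L^\infty(\Omega; \mathbf{R}^n)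 \to F$ be a linear map that is continuous for the weak* topology of $L^\infty(\Omega; \mathbf{R}^n) = L^1(\Omega; \mathbf{R}^n)^*$. Then $T(Q)$ is LNC. -/

import Mathlib

open MeasureTheory
open scoped ENNReal Topology

noncomputable section

/-- A set `Q` in a real topological vector space is locally nonconical if it is convex and, for all
`x, x' ∈ Q`, the points `y + (x' - x) / 2` lie in `Q` for all `y ∈ Q` close enough to `x`
(that is, eventually along every net in `Q` which converges to `x`). -/
def LocallyNonconical {F : Type*} [AddCommGroup F] [Module ℝ F] [TopologicalSpace F]
    (Q : Set F) : Prop :=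
  Convex ℝ Q ∧
    ∀ x ∈ Q, ∀ x' ∈ Q, ∀ᶠ y in 𝓝[Q] x, y + (1 / 2 : ℝ) • (x' - x) ∈ Q

/-- An atom of a vector measure `ν`: a measurable set `A` with `ν A ≠ 0`, every measurable
subset of which has measure `0` or `ν A`. -/
def IsVectorAtom {Ω F : Type*} [MeasurableSpace Ω] [AddCommGroup F] [TopologicalSpace F]
    (ν : VectorMeasure Ω F) (A : Set Ω) : Prop :=
  MeasurableSet A ∧ ν A ≠ 0 ∧ ∀ B, B ⊆ A → MeasurableSet B → ν B = 0 ∨ ν B = ν A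

/-- A vector measure is nonatomic if it has no atoms. -/
def IsNonatomic {Ω F : Type*} [MeasurableSpace Ω] [AddCommGroup F] [TopologicalSpace F]
    (ν : VectorMeasure Ω F) : Prop :=
  ∀ A, ¬ IsVectorAtom ν A

/-- The range of a vector measure; a zonoid is the range of a nonatomic one with values in a
finite-dimensional space. -/
def vectorMeasureRange {Ω F : Type*} [MeasurableSpace Ω] [AddCommGroup F] [TopologicalSpace F]
    (ν : VectorMeasure Ω F) : Set F :=
  {y | ∃ A, MeasurableSet A ∧ ν A = y}

/-- The set `L^∞(Ω; K)` of those elements of `L^∞(Ω; ℝⁿ)` whose values are in `K` almost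
everywhere. -/
def LinftyInto {Ω : Type*} [MeasurableSpace Ω] (μ : Measure Ω) {n : ℕ}
    (K : Set (EuclideanSpace ℝ (Fin n))) : Set (Lp (EuclideanSpace ℝ (Fin n)) ∞ μ) :=
  {f | ∀ᵐ ω ∂μ, f ω ∈ K}

/-- The weak* topology of `L^∞(Ω; ℝⁿ)` as the dual of `L^1(Ω; ℝⁿ)`: the coarsest topology for
which `f ↦ ∫ ⟪g, f⟫ dμ` is continuous for every `g` in `L^1(Ω; ℝⁿ)`. -/
def weakStarTopology {Ω : Type*} [MeasurableSpace Ω] (μ : Measure Ω) (n : ℕ) :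
    TopologicalSpace (Lp (EuclideanSpace ℝ (Fin n)) ∞ μ) :=
  ⨅ g : Lp (EuclideanSpace ℝ (Fin n)) 1 μ,
    TopologicalSpace.induced (fun f => ∫ ω, inner ℝ (g ω) (f ω) ∂μ) inferInstance

end

/-!
Both sets are Aumann integrals `Q = {∫ g ω (f ω) ∂μ : f a selection of K}` with `K` compact and
strictly convex. For `x, x' ∈ Q`, the claim at `x` is clear if the midpoint of `x` and `x'` is
interior to `Q`; otherwise a nonzero functional `ℓ` attains its maximum over `Q` at both `x` and
`x'`. Where `ℓ ∘ g ω ≠ 0`, it has a unique maximizer on `K`, so the selections of `x` and `x'` agree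
there, and those of points of `Q` close to `x` are close to them. Where `ℓ ∘ g ω = 0`, the integrals
lie in the kernel of `ℓ`, and one argues by induction on the dimension.

A nonatomic `ν` has a bounded density `g` with respect to its variation, a finite nonatomic measure.
By Lyapunov's theorem, each integral `∫ f • g` with `0 ≤ f ≤ 1` is also attained at an indicator
(an extreme point of the set of those `f` with the given integral), so the range of `ν` is the
Aumann integral with `K = [0, 1]`.
-/

open Filter Set

section Basics

variable {V W : Type*} [AddCommGroup V] [Module ℝ V] [TopologicalSpace V]
  [AddCommGroup W] [Module ℝ W] [TopologicalSpace W]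

theorem LocallyNonconical.of_image {Z : Set V} {p : Submodule ℝ V} (hZ : Z ⊆ p) (L : V →L[ℝ] W)
    (hL : InjOn L p) (h : LocallyNonconical (L '' Z)) : LocallyNonconical Z := by
  have mem_of_map_mem {v : V} (hv : v ∈ p) (hLv : L v ∈ L '' Z) : v ∈ Z := by
    obtain ⟨z, hz, hzv⟩ := hLv
    rwa [← hL (hZ hz) hv hzv]
  constructor
  · intro x hx y hy a b ha hb hab
    refine mem_of_map_mem (p.add_mem (p.smul_mem a (hZ hx)) (p.smul_mem b (hZ hy))) ?_
    simpa only [map_add, map_smul] using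
      h.1 (mem_image_of_mem L hx) (mem_image_of_mem L hy) ha hb hab
  · intro x hx x' hx'
    have hLx : Tendsto L (𝓝[Z] x) (𝓝[L '' Z] (L x)) :=
      L.continuous.continuousWithinAt.tendsto_nhdsWithin (mapsTo_image _ _)
    filter_upwards [hLx (h.2 _ (mem_image_of_mem L hx) _ (mem_image_of_mem L hx')),
      self_mem_nhdsWithin] with y hy hyZ
    refine mem_of_map_mem
      (p.add_mem (hZ hyZ) (p.smul_mem _ (p.sub_mem (hZ hx') (hZ hx)))) ?_
    simpa only [map_add, map_smul, map_sub, mem_preimage, mem_ofPred_eq] using hy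

end Basics

section Supporting

variable {V : Type*} [NormedAddCommGroup V] [NormedSpace ℝ V] [FiniteDimensional ℝ V] {Z : Set V}

theorem exists_ne_zero_isMaxOn_of_notMem_interior (hZ : Convex ℝ Z) {w : V} (hw : w ∈ Z)
    (hwi : w ∉ interior Z) : ∃ ℓ : V →L[ℝ] ℝ, ℓ ≠ 0 ∧ IsMaxOn ℓ Z w := by
  by_cases hne : (interior Z).Nonempty
  · exact geometric_hahn_banach_of_nonempty_interior_point hZ hwi hne
  · rw [hZ.interior_nonempty_iff_affineSpan_eq_top,
      AffineSubspace.affineSpan_eq_top_iff_vectorSpan_eq_top_of_nonempty _ _ _ ⟨w, hw⟩] at hne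
    obtain ⟨ℓ, hℓ, hker⟩ := Submodule.exists_le_ker_of_lt_top _ (lt_top_iff_ne_top.2 hne)
    refine ⟨ℓ.toContinuousLinearMap, by simpa using hℓ, fun z hz => ?_⟩
    have hzw : ℓ (z - w) = 0 := hker (vsub_mem_vectorSpan ℝ hz hw)
    exact (sub_eq_zero.1 ((map_sub ℓ z w).symm.trans hzw)).le

theorem locallyNonconical_of_forall_isMaxOn (hZ : Convex ℝ Z)
    (h : ∀ ℓ : V →L[ℝ] ℝ, ℓ ≠ 0 → ∀ x ∈ Z, ∀ x' ∈ Z, IsMaxOn ℓ Z x → IsMaxOn ℓ Z x' →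
      ∀ᶠ y in 𝓝[Z] x, y + (1 / 2 : ℝ) • (x' - x) ∈ Z) :
    LocallyNonconical Z := by
  refine ⟨hZ, fun x hx x' hx' => ?_⟩
  set w := x + (1 / 2 : ℝ) • (x' - x)
  have hw : w ∈ Z := hZ.add_smul_sub_mem hx hx' (by norm_num)
  by_cases hwi : w ∈ interior Z
  · have hcont : Tendsto (fun y => y + (1 / 2 : ℝ) • (x' - x)) (𝓝 x) (𝓝 w) :=
      (continuous_add_const _).tendsto x
    exact nhdsWithin_le_nhds (hcont (mem_interior_iff_mem_nhds.1 hwi))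
  · obtain ⟨ℓ, hℓ, hmax⟩ := exists_ne_zero_isMaxOn_of_notMem_interior hZ hw hwi
    have hℓw : ℓ w = ℓ x + 1 / 2 * (ℓ x' - ℓ x) := by simp [w]
    have hle (z : V) (hz : z ∈ Z) : ℓ z ≤ ℓ w := hmax hz
    have hℓx : ℓ x = ℓ w := by linarith [hle x hx, hle x' hx']
    have hℓx' : ℓ x' = ℓ w := by linarith
    exact h ℓ hℓ x hx x' hx' (fun z hz => (hle z hz).trans_eq hℓx.symm)
      fun z hz => (hle z hz).trans_eq hℓx'.symm

end Supporting

section Argmax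

variable {E : Type*} [NormedAddCommGroup E] [NormedSpace ℝ E] {K : Set E} {φ : E →L[ℝ] ℝ} {q : E}

theorem eq_of_isMaxOn_of_strictConvex (hK : StrictConvex ℝ K) (hφ : φ ≠ 0) {p : E}
    (hp : p ∈ K) (hq : q ∈ K) (hpm : IsMaxOn φ K p) (hqm : IsMaxOn φ K q) : p = q := by
  by_contra hne
  have hpq : φ p = φ q := le_antisymm (hqm hp) (hpm hq)
  set m := (1 / 2 : ℝ) • p + (1 / 2 : ℝ) • q
  have hm : m ∈ interior K := hK hp hq hne (by norm_num) (by norm_num) (by norm_num)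
  have hφm : φ m = φ p := by
    simp only [m, map_add, map_smul, smul_eq_mul, ← hpq]
    ring
  have hmax : IsMaxOn φ K m := fun y hy => (hpm hy).trans_eq hφm.symm
  have hderiv := (hmax.isLocalMax (mem_interior_iff_mem_nhds.1 hm)).fderiv_eq_zero
  exact hφ (φ.fderiv.symm.trans hderiv)

theorem tendsto_of_tendsto_isMaxOn_of_strictConvex (hK : StrictConvex ℝ K) (hc : IsCompact K)
    (hφ : φ ≠ 0) (hq : q ∈ K) (hqm : IsMaxOn φ K q) {ι : Type*} {l : Filter ι} {p : ι → E}
    (hp : ∀ᶠ i in l, p i ∈ K) (hφp : Tendsto (fun i => φ (p i)) l (𝓝 (φ q))) :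
    Tendsto p l (𝓝 q) := by
  refine hc.tendsto_nhds_of_unique_mapClusterPt hp fun y hy hcluster => ?_
  have hφy : MapClusterPt (φ y) l (fun i => φ (p i)) :=
    hcluster.continuousAt_comp φ.continuous.continuousAt
  have hyq : φ y = φ q := eq_of_nhds_neBot (ClusterPt.mono hφy hφp)
  exact eq_of_isMaxOn_of_strictConvex hK hφ hy hq (fun z hz => (hqm hz).trans_eq hyq.symm) hqm

end Argmax

/-- The (a.e. classes of) measurable selections of the constant multifunction `K`, represented by
a.e. strongly measurable functions which take values in `K` almost everywhere. -/
def measurableSelections {Ω E : Type*} [MeasurableSpace Ω] [TopologicalSpace E] (μ : Measure Ω)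
    (K : Set E) : Set (Ω → E) :=
  {f | AEStronglyMeasurable f μ ∧ ∀ᵐ ω ∂μ, f ω ∈ K}

/-- The Aumann integral of the multifunction `ω ↦ g ω '' K`, that is, the set of the integrals of
its measurable selections of the form `ω ↦ g ω (f ω)`. -/
def aumannIntegral {Ω E V : Type*} [MeasurableSpace Ω] [NormedAddCommGroup E]
    [NormedSpace ℝ E] [NormedAddCommGroup V] [NormedSpace ℝ V]
    (μ : Measure Ω) (g : Ω → E →L[ℝ] V) (K : Set E) : Set V :=
  (fun f : Ω → E => ∫ ω, g ω (f ω) ∂μ) '' measurableSelections μ K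

section Selections

variable {Ω E : Type*} [MeasurableSpace Ω] {μ : Measure Ω} {f f' : Ω → E} {A : Set Ω}

section Topological

variable [TopologicalSpace E] {K : Set E}

theorem measurableSelections_restrict (hf : f ∈ measurableSelections μ K) (A : Set Ω) :
    f ∈ measurableSelections (μ.restrict A) K :=
  ⟨hf.1.restrict, ae_restrict_of_ae hf.2⟩

theorem piecewise_mem_measurableSelections [DecidablePred (· ∈ A)] (hA : MeasurableSet A)
    (hf : f ∈ measurableSelections (μ.restrict A) K)
    (hf' : f' ∈ measurableSelections (μ.restrict Aᶜ) K) :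
    A.piecewise f f' ∈ measurableSelections μ K := by
  refine ⟨.piecewise hA hf.1 hf'.1, ae_of_ae_restrict_of_ae_restrict_compl A ?_ ?_⟩
  · filter_upwards [hf.2, ae_restrict_mem hA] with ω hω hωA
    rwa [piecewise_eq_of_mem _ _ _ hωA]
  · filter_upwards [hf'.2, ae_restrict_mem hA.compl] with ω hω hωA
    rwa [piecewise_eq_of_notMem _ _ _ hωA]

end Topological

variable {V : Type*} [NormedAddCommGroup E] [NormedSpace ℝ E] [NormedAddCommGroup V]
  [NormedSpace ℝ V] {g : Ω → E →L[ℝ] V} {K : Set E}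

theorem convex_measurableSelections (hK : Convex ℝ K) : Convex ℝ (measurableSelections μ K) := by
  intro f hf f' hf' a b ha hb hab
  refine ⟨(hf.1.const_smul a).add (hf'.1.const_smul b), ?_⟩
  filter_upwards [hf.2, hf'.2] with ω h h'
  exact hK h h' ha hb hab

theorem integrable_apply_selection (hg : Integrable g μ) (hK : Bornology.IsBounded K)
    (hf : f ∈ measurableSelections μ K) : Integrable (fun ω => g ω (f ω)) μ := by
  obtain ⟨R, hR⟩ := hK.exists_norm_le
  refine (hg.norm.mul_const R).mono'
    ((ContinuousLinearMap.id ℝ (E →L[ℝ] V)).aestronglyMeasurable_comp₂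
      hg.aestronglyMeasurable hf.1) ?_
  filter_upwards [hf.2] with ω hω
  exact (g ω).le_opNorm_of_le (hR _ hω)

theorem convex_aumannIntegral (hg : Integrable g μ) (hb : Bornology.IsBounded K)
    (hK : Convex ℝ K) : Convex ℝ (aumannIntegral μ g K) := by
  rintro _ ⟨f, hf, rfl⟩ _ ⟨f', hf', rfl⟩ a b ha hb' hab
  refine ⟨a • f + b • f', convex_measurableSelections hK hf hf' ha hb' hab, ?_⟩
  have hfi := integrable_apply_selection hg hb hf
  have hfi' := integrable_apply_selection hg hb hf'
  simp only [Pi.add_apply, Pi.smul_apply, map_add, map_smul]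
  rw [integral_add (hfi.fun_smul a) (hfi'.fun_smul b), integral_smul, integral_smul]

theorem integral_piecewise_selection [DecidablePred (· ∈ A)] (hg : Integrable g μ)
    (hb : Bornology.IsBounded K) (hA : MeasurableSet A)
    (hf : f ∈ measurableSelections (μ.restrict A) K)
    (hf' : f' ∈ measurableSelections (μ.restrict Aᶜ) K) :
    ∫ ω, g ω (A.piecewise f f' ω) ∂μ = ∫ ω in A, g ω (f ω) ∂μ + ∫ ω in Aᶜ, g ω (f' ω) ∂μ := by
  rw [← integral_piecewise hA (integrable_apply_selection hg.restrict hb hf)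
    (integrable_apply_selection hg.restrict hb hf')]
  exact integral_congr_ae (.of_forall fun ω => A.apply_piecewise f f' fun ω => g ω)

theorem add_mem_aumannIntegral (hg : Integrable g μ) (hb : Bornology.IsBounded K)
    (hA : MeasurableSet A) {x y : V} (hx : x ∈ aumannIntegral (μ.restrict A) g K)
    (hy : y ∈ aumannIntegral (μ.restrict Aᶜ) g K) : x + y ∈ aumannIntegral μ g K := by
  classical
  obtain ⟨f, hf, rfl⟩ := hx
  obtain ⟨f', hf', rfl⟩ := hy
  exact ⟨A.piecewise f f', piecewise_mem_measurableSelections hA hf hf',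
    integral_piecewise_selection hg hb hA hf hf'⟩

theorem aumannIntegral_comp {W : Type*} [NormedAddCommGroup W] [NormedSpace ℝ W]
    [CompleteSpace V] [CompleteSpace W] (hg : Integrable g μ) (hb : Bornology.IsBounded K)
    (L : V →L[ℝ] W) :
    aumannIntegral μ (fun ω => L.comp (g ω)) K = L '' aumannIntegral μ g K := by
  rw [aumannIntegral, aumannIntegral, image_image]
  exact image_congr fun f hf => L.integral_comp_comm (integrable_apply_selection hg hb hf)

end Selections

section Maximizers

variable {Ω : Type*} [MeasurableSpace Ω] {μ : Measure Ω}

theorem exists_seq_tendsto_ae_of_tendsto_integral {u : ℕ → Ω → ℝ} {v : Ω → ℝ}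
    (hu : ∀ k, Integrable (u k) μ) (hv : Integrable v μ) (huv : ∀ k, u k ≤ᵐ[μ] v)
    (hlim : Tendsto (fun k => ∫ ω, u k ω ∂μ) atTop (𝓝 (∫ ω, v ω ∂μ))) :
    ∃ ns : ℕ → ℕ, StrictMono ns ∧ ∀ᵐ ω ∂μ, Tendsto (fun k => u (ns k) ω) atTop (𝓝 (v ω)) := by
  have hnorm (k : ℕ) :
      eLpNorm (u k - v) 1 μ = ENNReal.ofReal (∫ ω, v ω ∂μ - ∫ ω, u k ω ∂μ) := by
    have hnonneg : 0 ≤ᵐ[μ] v - u k := (huv k).mono fun ω hω => sub_nonneg.2 hω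
    rw [eLpNorm_sub_comm, eLpNorm_one_eq_lintegral_enorm, ← integral_sub' hv (hu k),
      ofReal_integral_eq_lintegral_ofReal (hv.sub (hu k)) hnonneg]
    exact lintegral_congr_ae (hnonneg.mono fun ω hω => Real.enorm_of_nonneg hω)
  have hmeas : TendstoInMeasure μ u atTop v := by
    refine tendstoInMeasure_of_tendsto_eLpNorm one_ne_zero
      (fun k => (hu k).aestronglyMeasurable) hv.aestronglyMeasurable ?_
    simpa only [hnorm, sub_self, ENNReal.ofReal_zero] using
      ENNReal.tendsto_ofReal (hlim.const_sub (∫ ω, v ω ∂μ))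
  exact hmeas.exists_seq_tendsto_ae

variable {E : Type*} [NormedAddCommGroup E] [NormedSpace ℝ E] {K : Set E} {f : Ω → E}

theorem ae_isMaxOn_of_forall_integral_le {φ : Ω → E →L[ℝ] ℝ} (hφ : Integrable φ μ)
    (hc : IsCompact K) (hf : f ∈ measurableSelections μ K)
    (hmax : ∀ p ∈ measurableSelections μ K, ∫ ω, φ ω (p ω) ∂μ ≤ ∫ ω, φ ω (f ω) ∂μ) :
    ∀ᵐ ω ∂μ, IsMaxOn (φ ω) K (f ω) := by
  classical
  have hb := hc.isBounded
  have hfi := integrable_apply_selection hφ hb hf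
  have hconst (d : E) (hd : d ∈ K) : ∀ᵐ ω ∂μ, φ ω d ≤ φ ω (f ω) := by
    refine ae_le_of_forall_setIntegral_le (hφ.apply_continuousLinearMap d) hfi fun s hs _ => ?_
    have hds : (fun _ => d) ∈ measurableSelections (μ.restrict s) K :=
      ⟨aestronglyMeasurable_const, .of_forall fun _ => hd⟩
    have hle := hmax _ (piecewise_mem_measurableSelections hs hds
      (measurableSelections_restrict hf sᶜ))
    rw [integral_piecewise_selection hφ hb hs hds (measurableSelections_restrict hf sᶜ),
      ← integral_add_compl hs hfi] at hle
    exact le_of_add_le_add_right hle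
  obtain ⟨D, hDK, hD, hKD⟩ := hc.isSeparable.exists_countable_dense_subset
  filter_upwards [(ae_ball_iff hD).2 fun d hd => hconst d (hDK hd)] with ω hω z hz
  exact closure_minimal hω (isClosed_le (φ ω).continuous continuous_const) (hKD hz)

variable {V : Type*} [NormedAddCommGroup V] [NormedSpace ℝ V] [CompleteSpace V]
  {g : Ω → E →L[ℝ] V} {ℓ : V →L[ℝ] ℝ}

theorem tendsto_setIntegral_of_tendsto_isMaxOn (hg : Integrable g μ) (hc : IsCompact K)
    (hK : StrictConvex ℝ K) (hf : f ∈ measurableSelections μ K)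
    (hmax : ∀ᵐ ω ∂μ, IsMaxOn (ℓ.comp (g ω)) K (f ω)) {B : Set Ω}
    (hB : ∀ᵐ ω ∂μ.restrict B, ℓ.comp (g ω) ≠ 0) {ι : Type*} {l : Filter ι}
    [l.IsCountablyGenerated] {q : ι → Ω → E} (hq : ∀ i, q i ∈ measurableSelections μ K)
    (hlim : Tendsto (fun i => ℓ (∫ ω, g ω (q i ω) ∂μ)) l (𝓝 (ℓ (∫ ω, g ω (f ω) ∂μ)))) :
    Tendsto (fun i => ∫ ω in B, g ω (q i ω) ∂μ) l (𝓝 (∫ ω in B, g ω (f ω) ∂μ)) := by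
  refine tendsto_of_seq_tendsto fun s hs => tendsto_of_subseq_tendsto fun ns hns => ?_
  have hfi := integrable_apply_selection hg hc.isBounded hf
  have hqi (i : ι) := integrable_apply_selection hg hc.isBounded (hq i)
  have hle (k : ℕ) : (fun ω => ℓ (g ω (q (s (ns k)) ω))) ≤ᵐ[μ] fun ω => ℓ (g ω (f ω)) := by
    filter_upwards [hmax, (hq (s (ns k))).2] with ω hω hqω
    exact hω hqω
  obtain ⟨ms, -, hms⟩ := exists_seq_tendsto_ae_of_tendsto_integral
    (fun k => ℓ.integrable_comp (hqi (s (ns k)))) (ℓ.integrable_comp hfi) hle (by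
      simpa only [ℓ.integral_comp_comm, hfi, hqi, Function.comp_def] using
        hlim.comp (hs.comp hns))
  obtain ⟨R, hR⟩ := hc.isBounded.exists_norm_le
  refine ⟨ms, tendsto_integral_of_dominated_convergence (fun ω => ‖g ω‖ * R)
    (fun k => (hqi _).aestronglyMeasurable.restrict) (hg.norm.mul_const R).restrict
    (fun k => ae_restrict_of_ae ?_) ?_⟩
  · filter_upwards [(hq (s (ns (ms k)))).2] with ω hω
    exact (g ω).le_opNorm_of_le (hR _ hω)
  · have hqK : ∀ᵐ ω ∂μ, ∀ k, q (s (ns (ms k))) ω ∈ K := ae_all_iff.2 fun k => (hq _).2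
    filter_upwards [hB, ae_restrict_of_ae hms, ae_restrict_of_ae hmax, ae_restrict_of_ae hf.2,
      ae_restrict_of_ae hqK] with ω hne hlimω hmaxω hfω hqω
    exact ((g ω).continuous.tendsto _).comp (tendsto_of_tendsto_isMaxOn_of_strictConvex hK hc hne
      hfω hmaxω (.of_forall hqω) hlimω)

end Maximizers

section AumannIntegral

variable {Ω E : Type*} [MeasurableSpace Ω] {μ : Measure Ω} [NormedAddCommGroup E]
  [NormedSpace ℝ E] {K : Set E} {V : Type*} [NormedAddCommGroup V] [NormedSpace ℝ V]
  {g : Ω → E →L[ℝ] V} {ℓ : V →L[ℝ] ℝ}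

section Maximizers

variable [CompleteSpace V] {f f' : Ω → E}

theorem ae_isMaxOn_of_isMaxOn_aumannIntegral (hg : Integrable g μ) (hc : IsCompact K)
    (hf : f ∈ measurableSelections μ K)
    (hmax : IsMaxOn ℓ (aumannIntegral μ g K) (∫ ω, g ω (f ω) ∂μ)) :
    ∀ᵐ ω ∂μ, IsMaxOn (ℓ.comp (g ω)) K (f ω) := by
  refine ae_isMaxOn_of_forall_integral_le
    ((ContinuousLinearMap.compL ℝ E V ℝ ℓ).integrable_comp hg) hc hf fun p hp => ?_
  simp only [ContinuousLinearMap.comp_apply]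
  rw [ℓ.integral_comp_comm (integrable_apply_selection hg hc.isBounded hp),
    ℓ.integral_comp_comm (integrable_apply_selection hg hc.isBounded hf)]
  exact hmax (mem_image_of_mem _ hp)

theorem setIntegral_eq_of_isMaxOn_aumannIntegral (hg : Integrable g μ)
    (hc : IsCompact K) (hK : StrictConvex ℝ K)
    (hf : f ∈ measurableSelections μ K) (hf' : f' ∈ measurableSelections μ K)
    (hmax : IsMaxOn ℓ (aumannIntegral μ g K) (∫ ω, g ω (f ω) ∂μ))
    (hmax' : IsMaxOn ℓ (aumannIntegral μ g K) (∫ ω, g ω (f' ω) ∂μ)) {B : Set Ω}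
    (hB : ∀ᵐ ω ∂μ.restrict B, ℓ.comp (g ω) ≠ 0) :
    ∫ ω in B, g ω (f' ω) ∂μ = ∫ ω in B, g ω (f ω) ∂μ := by
  refine integral_congr_ae ?_
  filter_upwards [hB, ae_restrict_of_ae hf.2, ae_restrict_of_ae hf'.2,
    ae_restrict_of_ae (ae_isMaxOn_of_isMaxOn_aumannIntegral hg hc hf hmax),
    ae_restrict_of_ae (ae_isMaxOn_of_isMaxOn_aumannIntegral hg hc hf' hmax')]
    with ω hω hfω hfω' hmaxω hmaxω'
  rw [eq_of_isMaxOn_of_strictConvex hK hω hfω' hfω hmaxω' hmaxω]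

/- On `Aᶜ` the selections of `x` and `x'` agree and those of points near `x` converge to them, so
both the displacement `x' - x` and the variation of the remaining part take place on `A`. -/
theorem eventually_mem_aumannIntegral_of_isMaxOn (hg : Integrable g μ)
    (hc : IsCompact K) (hK : StrictConvex ℝ K) {A : Set Ω} (hA : MeasurableSet A)
    (hne : ∀ᵐ ω ∂μ.restrict Aᶜ, ℓ.comp (g ω) ≠ 0)
    (hlnc : LocallyNonconical (aumannIntegral (μ.restrict A) g K)) {x x' : V}
    (hx : x ∈ aumannIntegral μ g K) (hx' : x' ∈ aumannIntegral μ g K)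
    (hxmax : IsMaxOn ℓ (aumannIntegral μ g K) x) (hxmax' : IsMaxOn ℓ (aumannIntegral μ g K) x') :
    ∀ᶠ y in 𝓝[aumannIntegral μ g K] x, y + (1 / 2 : ℝ) • (x' - x) ∈ aumannIntegral μ g K := by
  have hb := hc.isBounded
  have mem_restrict {p : Ω → E} (hp : p ∈ measurableSelections μ K) (B : Set Ω) :
      ∫ ω in B, g ω (p ω) ∂μ ∈ aumannIntegral (μ.restrict B) g K :=
    mem_image_of_mem _ (measurableSelections_restrict hp B)
  have split {p : Ω → E} (hp : p ∈ measurableSelections μ K) :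
      ∫ ω, g ω (p ω) ∂μ = ∫ ω in A, g ω (p ω) ∂μ + ∫ ω in Aᶜ, g ω (p ω) ∂μ :=
    (integral_add_compl hA (integrable_apply_selection hg hb hp)).symm
  rw [nhdsWithin_eq_map_subtype_coe hx, eventually_map]
  choose q hq hqy using fun y : aumannIntegral μ g K => y.2
  obtain ⟨f, hf, rfl⟩ := hx
  obtain ⟨f', hf', rfl⟩ := hx'
  have hq_lim : Tendsto (fun y => ∫ ω, g ω (q y ω) ∂μ) (𝓝 ⟨_, mem_image_of_mem _ hf⟩)
      (𝓝 (∫ ω, g ω (f ω) ∂μ)) := by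
    simpa only [hqy] using (continuous_subtype_val (p := (· ∈ aumannIntegral μ g K))).tendsto _
  have hq_compl := tendsto_setIntegral_of_tendsto_isMaxOn hg hc hK hf
    (ae_isMaxOn_of_isMaxOn_aumannIntegral hg hc hf hxmax) hne hq
    ((ℓ.continuous.tendsto _).comp hq_lim)
  have hq_A : Tendsto (fun y => ∫ ω in A, g ω (q y ω) ∂μ) (𝓝 ⟨_, mem_image_of_mem _ hf⟩)
      (𝓝[aumannIntegral (μ.restrict A) g K] (∫ ω in A, g ω (f ω) ∂μ)) := by
    refine tendsto_nhdsWithin_iff.2 ⟨?_, .of_forall fun y => mem_restrict (hq y) A⟩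
    simpa only [split hf, split (hq _), add_sub_cancel_right] using hq_lim.sub hq_compl
  filter_upwards [hq_A (hlnc.2 _ (mem_restrict hf A) _ (mem_restrict hf' A))] with y hy
  convert add_mem_aumannIntegral hg hb hA hy (mem_restrict (hq y) Aᶜ) using 1
  rw [← hqy y]
  simp only [split (hq y), split hf, split hf',
    setIntegral_eq_of_isMaxOn_aumannIntegral hg hc hK hf hf' hxmax hxmax' hne]
  module

end Maximizers

variable [FiniteDimensional ℝ V]

theorem locallyNonconical_aumannIntegral_of_le_ker (hg : Integrable g μ)
    (hb : Bornology.IsBounded K) (hker : ∀ᵐ ω ∂μ, ℓ.comp (g ω) = 0)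
    (h : ∀ L : V →L[ℝ] ℓ.ker, LocallyNonconical (aumannIntegral μ (fun ω => L.comp (g ω)) K)) :
    LocallyNonconical (aumannIntegral μ g K) := by
  have hsub : aumannIntegral μ g K ⊆ ℓ.ker := by
    rintro _ ⟨f, hf, rfl⟩
    change ℓ (∫ ω, g ω (f ω) ∂μ) = 0
    rw [← ℓ.integral_comp_comm (integrable_apply_selection hg hb hf)]
    exact integral_eq_zero_of_ae (hker.mono fun ω hω => DFunLike.congr_fun hω (f ω))
  obtain ⟨L, hL⟩ := Submodule.ClosedComplemented.of_finiteDimensional ℓ.ker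
  refine .of_image hsub L (fun v hv w hw hvw => ?_) (aumannIntegral_comp hg hb L ▸ h L)
  simpa only [hL ⟨v, hv⟩, hL ⟨w, hw⟩, Subtype.mk.injEq] using hvw

theorem locallyNonconical_aumannIntegral (hc : IsCompact K) (hK : StrictConvex ℝ K)
    (hg : Integrable g μ) : LocallyNonconical (aumannIntegral μ g K) := by
  induction hd : Module.finrank ℝ V using Nat.strong_induction_on generalizing V μ with
  | _ d ih =>
  refine locallyNonconical_of_forall_isMaxOn (convex_aumannIntegral hg hc.isBounded hK.convex)
    fun ℓ hℓ x hx x' hx' hxmax hxmax' => ?_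
  have hℓg : AEStronglyMeasurable (fun ω => ℓ.comp (g ω)) μ :=
    ((ContinuousLinearMap.compL ℝ E V ℝ ℓ).integrable_comp hg).aestronglyMeasurable
  obtain ⟨A, -, hA, hAe⟩ := (hℓg.nullMeasurableSet_eq_fun
    aestronglyMeasurable_zero).exists_measurable_superset_ae_eq
  have hiff : ∀ᵐ ω ∂μ, ω ∈ A ↔ ℓ.comp (g ω) = 0 := hAe.mem_iff
  refine eventually_mem_aumannIntegral_of_isMaxOn hg hc hK hA ?_ ?_ hx hx' hxmax hxmax'
  · filter_upwards [ae_restrict_of_ae hiff, ae_restrict_mem hA.compl] with ω hω hωA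
    exact fun h0 => hωA (hω.2 h0)
  · refine locallyNonconical_aumannIntegral_of_le_ker (ℓ := ℓ) hg.restrict hc.isBounded ?_ fun L =>
      ih _ ?_ ((ContinuousLinearMap.compL ℝ E V _ L).integrable_comp hg.restrict) rfl
    · filter_upwards [ae_restrict_of_ae hiff, ae_restrict_mem hA] with ω hω hωA
      exact hω.1 hωA
    · rw [← hd]
      exact Submodule.finrank_lt fun h => hℓ
        (ContinuousLinearMap.coe_injective (LinearMap.ker_eq_top.1 h))

end AumannIntegral

section ExtremePoints

variable {H : Type*} [NormedAddCommGroup H] [InnerProductSpace ℝ H] [CompleteSpace H]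

theorem surjective_inclusionInDoubleDual_of_innerProductSpace :
    Function.Surjective (NormedSpace.inclusionInDoubleDual ℝ H) := by
  intro Φ
  let e := InnerProductSpace.toDual ℝ H
  obtain ⟨x, hx⟩ := e.surjective (Φ.comp (innerSL ℝ))
  refine ⟨x, ContinuousLinearMap.ext fun φ => ?_⟩
  obtain ⟨y, rfl⟩ := e.surjective φ
  rw [NormedSpace.dual_def, InnerProductSpace.toDual_apply_apply, real_inner_comm,
    ← InnerProductSpace.toDual_apply_apply, hx]
  rfl

theorem isCompact_toWeakSpace_image {C : Set H} (hcl : IsClosed C)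
    (hb : Bornology.IsBounded C) (hconv : Convex ℝ C) : IsCompact (toWeakSpace ℝ H '' C) := by
  have hclosed : closure (toWeakSpace ℝ H '' C) = toWeakSpace ℝ H '' C := by
    rw [← hconv.toWeakSpace_closure (𝕜 := ℝ), hcl.closure_eq]
  rw [← hclosed]
  refine NormedSpace.isCompact_closure_of_isBounded ℝ H _
    (by rwa [preimage_image_eq _ (toWeakSpace ℝ H).injective]) fun φ _ => ?_
  exact surjective_inclusionInDoubleDual_of_innerProductSpace φ

theorem extremePoints_nonempty_of_isClosed_of_isBounded {C : Set H} (hcl : IsClosed C)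
    (hb : Bornology.IsBounded C) (hconv : Convex ℝ C) (hne : C.Nonempty) :
    (C.extremePoints ℝ).Nonempty := by
  have : LocallyConvexSpace ℝ (WeakSpace ℝ H) := WeakBilin.locallyConvexSpace
  have h := (isCompact_toWeakSpace_image hcl hb hconv).extremePoints_nonempty (hne.image _)
  rwa [← image_extremePoints, image_nonempty] at h

end ExtremePoints

/-- A measure is nonatomic if every measurable set of nonzero measure splits into two measurable
sets of nonzero measure. This is the classical notion; Mathlib's `NoAtoms` only says that points
are null sets. -/
def IsNonatomicMeasure {Ω : Type*} [MeasurableSpace Ω] (μ : Measure Ω) : Prop :=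
  ∀ A, MeasurableSet A → μ A ≠ 0 → ∃ B ⊆ A, MeasurableSet B ∧ μ B ≠ 0 ∧ μ (A \ B) ≠ 0

/-- The set of those elements of `L^p(Ω; E)` whose values are in `K` almost everywhere; for
`p = ∞` and `E = ℝⁿ` it is `LinftyInto`. -/
def lpInto {Ω E : Type*} [MeasurableSpace Ω] [NormedAddCommGroup E] (p : ℝ≥0∞) (μ : Measure Ω)
    (K : Set E) : Set (Lp E p μ) :=
  {f | ∀ᵐ ω ∂μ, f ω ∈ K}

/-- The subspace of `L^p(Ω)` of the bounded functions which vanish outside `A`. -/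
def boundedSupportedOn {Ω : Type*} [MeasurableSpace Ω] (p : ℝ≥0∞) (μ : Measure Ω) (A : Set Ω) :
    Submodule ℝ (Lp ℝ p μ) where
  carrier := {f | ∃ M, ∀ᵐ ω ∂μ, |f ω| ≤ A.indicator (fun _ => M) ω}
  zero_mem' := by
    refine ⟨0, (Lp.coeFn_zero ℝ p μ).mono fun ω h => (congrArg abs h).le.trans ?_⟩
    rw [Pi.zero_apply, abs_zero, indicator_zero]
  add_mem' := by
    rintro f g ⟨M, hf⟩ ⟨N, hg⟩
    refine ⟨M + N, ?_⟩
    filter_upwards [hf, hg, Lp.coeFn_add f g] with ω hf hg h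
    rw [h, indicator_add]
    exact (abs_add_le _ _).trans (add_le_add hf hg)
  smul_mem' := by
    rintro c f ⟨M, hf⟩
    refine ⟨|c| * M, ?_⟩
    filter_upwards [hf, Lp.coeFn_smul c f] with ω hf h
    rw [h, Pi.smul_apply, smul_eq_mul, abs_mul, indicator_const_mul]
    exact mul_le_mul_of_nonneg_left hf (abs_nonneg c)

section LpInto

variable {Ω E : Type*} [MeasurableSpace Ω] {μ : Measure Ω} [NormedAddCommGroup E] {p : ℝ≥0∞}
  {K : Set E}

theorem convex_lpInto [NormedSpace ℝ E] (hK : Convex ℝ K) : Convex ℝ (lpInto p μ K) := by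
  intro f hf f' hf' a b ha hb hab
  filter_upwards [hf, hf', Lp.coeFn_add (a • f) (b • f'), Lp.coeFn_smul a f, Lp.coeFn_smul b f']
    with ω h h' hadd hsmul hsmul'
  rw [hadd, Pi.add_apply, hsmul, hsmul']
  exact hK h h' ha hb hab

theorem isClosed_lpInto [Fact (1 ≤ p)] (hK : IsClosed K) : IsClosed (lpInto p μ K) := by
  refine IsSeqClosed.isClosed fun f f₀ hf hlim => ?_
  obtain ⟨k, -, hk⟩ := (tendstoInMeasure_of_tendsto_Lp hlim).exists_seq_tendsto_ae
  filter_upwards [hk, ae_all_iff.2 hf] with ω hω hfω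
  exact hK.mem_of_tendsto hω (.of_forall fun i => hfω (k i))

theorem isBounded_lpInto [IsFiniteMeasure μ] [Fact (1 ≤ p)] (hK : Bornology.IsBounded K) :
    Bornology.IsBounded (lpInto p μ K) := by
  obtain ⟨R, hR⟩ := hK.exists_norm_le
  have hR' : ∀ x ∈ K, ‖x‖ ≤ max R 0 := fun x hx => (hR x hx).trans (le_max_left _ _)
  refine isBounded_iff_forall_norm_le.2 ⟨_, fun f hf =>
    Lp.norm_le_of_ae_bound (le_max_right R 0) ?_⟩
  filter_upwards [hf] with ω hω
  exact hR' _ hω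

theorem toLp_mem_lpInto {f : Ω → E} (hf : MemLp f p μ) : hf.toLp ∈ lpInto p μ K ↔
    ∀ᵐ ω ∂μ, f ω ∈ K :=
  eventually_congr (hf.coeFn_toLp.mono fun ω hω => by rw [hω])

end LpInto

section Lyapunov

variable {Ω : Type*} [MeasurableSpace Ω] {μ : Measure Ω}

theorem IsNonatomicMeasure.exists_seq_disjoint (hμ : IsNonatomicMeasure μ) {A : Set Ω}
    (hA : MeasurableSet A) (hμA : μ A ≠ 0) :
    ∃ s : ℕ → Set Ω, Pairwise (Function.onFun Disjoint s) ∧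
      ∀ k, s k ⊆ A ∧ MeasurableSet (s k) ∧ μ (s k) ≠ 0 := by
  choose! b hbA hbm hb hdiff using hμ
  let D : ℕ → Set Ω := fun k => (fun D => D \ b D)^[k] A
  have hDsucc : ∀ k, D (k + 1) = D k \ b (D k) := fun k => Function.iterate_succ_apply' _ k A
  have hD : ∀ k, MeasurableSet (D k) ∧ μ (D k) ≠ 0 := fun k => by
    induction k with
    | zero => exact ⟨hA, hμA⟩
    | succ k ih =>
      rw [hDsucc]
      exact ⟨ih.1.diff (hbm _ ih.1 ih.2), hdiff _ ih.1 ih.2⟩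
  have hanti : Antitone D := antitone_nat_of_succ_le fun k => (hDsucc k).trans_le sdiff_subset
  have hsub : ∀ k, b (D k) ⊆ D k := fun k => hbA _ (hD k).1 (hD k).2
  refine ⟨fun k => b (D k), (pairwise_disjoint_on _).2 fun m n hmn => ?_, fun k =>
    ⟨(hsub k).trans (hanti k.zero_le), hbm _ (hD k).1 (hD k).2, hb _ (hD k).1 (hD k).2⟩⟩
  have hn : b (D n) ⊆ D m \ b (D m) := (hsub n).trans (hDsucc m ▸ hanti (Nat.succ_le_of_lt hmn))
  exact disjoint_sdiff_right.mono_right hn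

theorem indicatorConstLp_mem_boundedSupportedOn {p : ℝ≥0∞} {A s : Set Ω} (hs : MeasurableSet s)
    (hμs : μ s ≠ ∞) (hsA : s ⊆ A) (c : ℝ) :
    indicatorConstLp p hs hμs c ∈ boundedSupportedOn p μ A := by
  refine ⟨|c|, ?_⟩
  filter_upwards [indicatorConstLp_coeFn (p := p) (hs := hs) (hμs := hμs) (c := c)] with ω h
  rw [h, ← Real.norm_eq_abs, norm_indicator_eq_indicator_norm, Real.norm_eq_abs]
  exact indicator_le_indicator_of_subset hsA (fun _ => abs_nonneg c) ω

theorem linearIndependent_indicatorConstLp {ι : Type*} {s : ι → Set Ω}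
    (hs : ∀ i, MeasurableSet (s i)) (hfin : ∀ i, μ (s i) ≠ ∞) (hpos : ∀ i, μ (s i) ≠ 0)
    (hdisj : Pairwise (Function.onFun Disjoint s)) :
    LinearIndependent ℝ fun i => indicatorConstLp 2 (hs i) (hfin i) (1 : ℝ) := by
  refine linearIndependent_of_ne_zero_of_inner_eq_zero (𝕜 := ℝ) (fun i h => ?_) fun i j hij => ?_
  · have hnorm := L2.real_inner_indicatorConstLp_one_indicatorConstLp_one (hs i) (hs i)
      (hfin i) (hfin i)
    rw [h, inner_zero_left, inter_self, measureReal_def, eq_comm,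
      ENNReal.toReal_eq_zero_iff] at hnorm
    exact hnorm.elim (hpos i) (hfin i)
  · simp only [L2.real_inner_indicatorConstLp_one_indicatorConstLp_one, (hdisj hij).inter_eq,
      measureReal_empty]

theorem IsNonatomicMeasure.not_finiteDimensional_boundedSupportedOn [IsFiniteMeasure μ]
    (hμ : IsNonatomicMeasure μ) {A : Set Ω} (hA : MeasurableSet A) (hμA : μ A ≠ 0) :
    ¬ FiniteDimensional ℝ (boundedSupportedOn 2 μ A) := by
  intro hfin
  obtain ⟨s, hdisj, hs⟩ := hμ.exists_seq_disjoint hA hμA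
  have hli : LinearIndependent ℝ fun k => (⟨_, indicatorConstLp_mem_boundedSupportedOn (hs k).2.1
      (measure_ne_top μ (s k)) (hs k).1 1⟩ : boundedSupportedOn 2 μ A) :=
    .of_comp (Submodule.subtype _) <| linearIndependent_indicatorConstLp
      (fun k => (hs k).2.1) (fun k => measure_ne_top μ (s k)) (fun k => (hs k).2.2) hdisj
  exact not_finite_iff_infinite.2 inferInstance hli.finite

variable {V : Type*} [AddCommGroup V] [Module ℝ V] [FiniteDimensional ℝ V]

theorem IsNonatomicMeasure.exists_ne_zero_map_eq_zero [IsFiniteMeasure μ]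
    (hμ : IsNonatomicMeasure μ) (Φ : Lp ℝ 2 μ →ₗ[ℝ] V) {A : Set Ω} (hA : MeasurableSet A)
    (hμA : μ A ≠ 0) {ε : ℝ} (hε : 0 < ε) :
    ∃ h : Lp ℝ 2 μ, h ≠ 0 ∧ Φ h = 0 ∧ ∀ᵐ ω ∂μ, |h ω| ≤ A.indicator (fun _ => ε) ω := by
  obtain ⟨⟨h, M, hM⟩, hΦ, hne⟩ : ∃ h : boundedSupportedOn 2 μ A, Φ h = 0 ∧ h ≠ 0 := by
    by_contra! hker
    exact hμ.not_finiteDimensional_boundedSupportedOn hA hμA <| .of_injective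
      (Φ.domRestrict _) (LinearMap.ker_eq_bot.1 (LinearMap.ker_eq_bot'.2 hker))
  obtain ⟨t, ht, htM⟩ := exists_pos_mul_lt hε M
  refine ⟨t • h, smul_ne_zero ht.ne' fun h0 => hne (Subtype.ext h0), by simp [hΦ], ?_⟩
  filter_upwards [hM, Lp.coeFn_smul t h] with ω hω hsmul
  rw [hsmul, Pi.smul_apply, smul_eq_mul, abs_mul, abs_of_pos ht]
  refine (mul_le_mul_of_nonneg_left hω ht.le).trans ?_
  rw [← indicator_const_mul, mul_comm]
  exact indicator_le_indicator htM.le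

theorem exists_measure_preimage_Icc_ne_zero {u : Ω → ℝ} (hu : μ (u ⁻¹' Ioo 0 1) ≠ 0) :
    ∃ ε > 0, μ (u ⁻¹' Icc ε (1 - ε)) ≠ 0 := by
  have hcover : u ⁻¹' Ioo (0 : ℝ) 1 ⊆
      ⋃ k : ℕ, u ⁻¹' Icc (1 / ((k : ℝ) + 1)) (1 - 1 / ((k : ℝ) + 1)) := by
    intro ω hω
    obtain ⟨k, hk⟩ := exists_nat_one_div_lt (lt_min hω.1 (sub_pos.2 hω.2))
    rw [lt_min_iff, lt_sub_comm] at hk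
    exact mem_iUnion.2 ⟨k, hk.1.le, hk.2.le⟩
  obtain ⟨k, hk⟩ := exists_measure_pos_of_not_measure_iUnion_null
    fun h => hu (measure_mono_null hcover h)
  exact ⟨_, Nat.one_div_pos_of_nat, hk.ne'⟩

theorem add_smul_mem_lpInto_Icc {p : ℝ≥0∞} {u h : Lp ℝ p μ} {ε σ : ℝ} (hσ : |σ| ≤ 1)
    (hu : u ∈ lpInto p μ (Icc 0 1))
    (hh : ∀ᵐ ω ∂μ, |h ω| ≤ (u ⁻¹' Icc ε (1 - ε)).indicator (fun _ => ε) ω) :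
    u + σ • h ∈ lpInto p μ (Icc 0 1) := by
  filter_upwards [hu, hh, Lp.coeFn_add u (σ • h), Lp.coeFn_smul σ h] with ω hu hh hadd hsmul
  rw [hadd, Pi.add_apply, hsmul, Pi.smul_apply, smul_eq_mul]
  have hσh : |σ * h ω| ≤ |h ω| := by
    rw [abs_mul]
    exact mul_le_of_le_one_left (abs_nonneg _) hσ
  have hbound := abs_le.1 (hσh.trans hh)
  by_cases hω : ω ∈ u ⁻¹' Icc ε (1 - ε)
  · rw [indicator_of_mem hω] at hbound
    exact ⟨by linarith [hω.1], by linarith [hω.2]⟩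
  · rw [indicator_of_notMem hω, neg_zero] at hbound
    rwa [le_antisymm hbound.2 hbound.1, add_zero]

/- Where `ε ≤ u ≤ 1 - ε`, an extreme point `u` could be perturbed in both directions by a bounded
function in the kernel of `Φ`, as there are infinitely many independent ones. -/
theorem IsNonatomicMeasure.ae_eq_zero_or_eq_one_of_mem_extremePoints [IsFiniteMeasure μ]
    (hμ : IsNonatomicMeasure μ) (Φ : Lp ℝ 2 μ →ₗ[ℝ] V) {x : V} {u : Lp ℝ 2 μ}
    (hu : u ∈ (lpInto 2 μ (Icc 0 1) ∩ Φ ⁻¹' {x}).extremePoints ℝ) :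
    ∀ᵐ ω ∂μ, u ω = 0 ∨ u ω = 1 := by
  obtain ⟨⟨huI, hux⟩, hext⟩ := mem_extremePoints.1 hu
  have hnull : μ (u ⁻¹' Ioo 0 1) = 0 := by
    by_contra hpos
    obtain ⟨ε, hε, hμε⟩ := exists_measure_preimage_Icc_ne_zero hpos
    obtain ⟨h, hne, hΦ, hh⟩ := hμ.exists_ne_zero_map_eq_zero Φ
      ((Lp.stronglyMeasurable u).measurable measurableSet_Icc) hμε hε
    have hmem : ∀ σ : ℝ, |σ| ≤ 1 → u + σ • h ∈ lpInto 2 μ (Icc 0 1) ∩ Φ ⁻¹' {x} := fun σ hσ =>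
      ⟨add_smul_mem_lpInto_Icc hσ huI hh, by
        rwa [mem_preimage, map_add, map_smul, hΦ, smul_zero, add_zero]⟩
    have hseg : u ∈ openSegment ℝ (u + (1 : ℝ) • h) (u + (-1 : ℝ) • h) :=
      ⟨1 / 2, 1 / 2, by norm_num, by norm_num, by norm_num, by module⟩
    have heq := (hext _ (hmem 1 (by simp)) _ (hmem (-1) (by simp)) hseg).1
    rw [one_smul, add_eq_left] at heq
    exact hne heq
  filter_upwards [huI, measure_eq_zero_iff_ae_notMem.1 hnull] with ω hI hnot
  exact (hI.1.eq_or_lt).imp Eq.symm fun h0 => hI.2.eq_or_lt.resolve_right fun h1 => hnot ⟨h0, h1⟩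

theorem exists_eq_indicatorConstLp [IsFiniteMeasure μ] {p : ℝ≥0∞} {u : Lp ℝ p μ}
    (hu : ∀ᵐ ω ∂μ, u ω = 0 ∨ u ω = 1) :
    ∃ (B : Set Ω) (hB : MeasurableSet B), u = indicatorConstLp p hB (measure_ne_top μ B) 1 := by
  have hB : MeasurableSet (u ⁻¹' {1}) :=
    (Lp.stronglyMeasurable u).measurable (measurableSet_singleton 1)
  refine ⟨_, hB, Lp.ext ?_⟩
  filter_upwards [hu, indicatorConstLp_coeFn (p := p) (hs := hB)
    (hμs := measure_ne_top μ _) (c := (1 : ℝ))] with ω hω h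
  rw [h]
  rcases hω with hω | hω <;> simp [hω]

theorem IsNonatomicMeasure.exists_map_indicatorConstLp_eq [IsFiniteMeasure μ]
    [TopologicalSpace V] [T1Space V] (hμ : IsNonatomicMeasure μ) (Φ : Lp ℝ 2 μ →L[ℝ] V)
    {f : Lp ℝ 2 μ} (hf : f ∈ lpInto 2 μ (Icc 0 1)) :
    ∃ (B : Set Ω) (hB : MeasurableSet B),
      Φ (indicatorConstLp 2 hB (measure_ne_top μ B) 1) = Φ f := by
  have hconv : Convex ℝ (lpInto 2 μ (Icc 0 1) ∩ Φ ⁻¹' {Φ f}) :=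
    (convex_lpInto (convex_Icc 0 1)).inter ((convex_singleton _).is_linear_preimage Φ.isLinear)
  obtain ⟨u, hu⟩ := extremePoints_nonempty_of_isClosed_of_isBounded
    ((isClosed_lpInto isClosed_Icc).inter (isClosed_singleton.preimage Φ.continuous))
    ((isBounded_lpInto (Metric.isBounded_Icc 0 1)).subset inter_subset_left) hconv ⟨f, hf, rfl⟩
  obtain ⟨B, hB, rfl⟩ := exists_eq_indicatorConstLp
    (hμ.ae_eq_zero_or_eq_one_of_mem_extremePoints (Φ : Lp ℝ 2 μ →ₗ[ℝ] V) hu)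
  exact ⟨B, hB, hu.1.2⟩

end Lyapunov

section VectorMeasure

variable {Ω : Type*} [MeasurableSpace Ω] {μ : Measure Ω}

section Polar

variable {ι : Type*}

/-- The coordinates of a vector measure with values in `ι → ℝ`, which are signed measures. -/
def vectorMeasureCoord (ν : VectorMeasure Ω (ι → ℝ)) (i : ι) : SignedMeasure Ω :=
  ν.mapRange (Pi.evalAddMonoidHom _ i) (continuous_apply i)

variable [Fintype ι] {ν : VectorMeasure Ω (ι → ℝ)}

theorem isFiniteMeasure_variation_pi (ν : VectorMeasure Ω (ι → ℝ)) :
    IsFiniteMeasure ν.variation := by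
  classical
  refine isFiniteMeasure_of_le (∑ i, (vectorMeasureCoord ν i).totalVariation)
    (VectorMeasure.variation_le_of_forall_enorm_le fun A _ => ?_)
  calc ‖ν A‖ₑ = ‖∑ i, Pi.single i (ν A i)‖ₑ := by rw [Finset.univ_sum_single]
    _ ≤ ∑ i, ‖ν A i‖ₑ := (enorm_sum_le _ _).trans_eq (by simp only [Pi.enorm_single])
    _ ≤ ∑ i, (vectorMeasureCoord ν i).totalVariation A :=
      Finset.sum_le_sum fun i _ => (vectorMeasureCoord ν i).enorm_le_totalVariation A
    _ = _ := (Measure.finsetSum_apply _ _ A).symm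

theorem exists_withDensityᵥ_eq_of_absolutelyContinuous [SigmaFinite μ]
    (h : ν ≪ᵥ μ.toENNRealVectorMeasure) :
    ∃ g : Ω → ι → ℝ, Integrable g μ ∧ μ.withDensityᵥ g = ν := by
  let g : Ω → ι → ℝ := fun ω i => (vectorMeasureCoord ν i).rnDeriv μ ω
  have hgi : ∀ i, Integrable (g · i) μ := fun i => SignedMeasure.integrable_rnDeriv _ _
  have hg : Integrable g μ := .of_eval hgi
  have hcoord : ∀ i, μ.withDensityᵥ (g · i) = vectorMeasureCoord ν i := fun i =>
    SignedMeasure.withDensityᵥ_rnDeriv_eq _ μ fun _ hA => congrFun (h hA) i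
  refine ⟨g, hg, VectorMeasure.ext fun A hA => funext fun i => ?_⟩
  rw [withDensityᵥ_apply hg hA, eval_integral fun i => (hgi i).restrict,
    ← withDensityᵥ_apply (hgi i) hA, hcoord]
  rfl

theorem exists_norm_eq_one_withDensityᵥ_variation_eq (ν : VectorMeasure Ω (ι → ℝ)) :
    ∃ g : Ω → ι → ℝ, Integrable g ν.variation ∧ (∀ᵐ ω ∂ν.variation, ‖g ω‖ = 1) ∧
      ν.variation.withDensityᵥ g = ν := by
  have := isFiniteMeasure_variation_pi ν
  obtain ⟨g, hg, hν⟩ := exists_withDensityᵥ_eq_of_absolutelyContinuous (ν := ν)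
    (μ := ν.variation) fun A hA => by
      by_cases hAm : MeasurableSet A
      · rw [Measure.toENNRealVectorMeasure_apply_measurable hAm,
          VectorMeasure.variation_apply_eq_zero hAm] at hA
        exact hA A Subset.rfl hAm
      · exact ν.not_measurable hAm
  have hdens : ν.variation.withDensity (fun ω => ‖g ω‖ₑ) = ν.variation.withDensity 1 := by
    rw [withDensity_one, ← Measure.variation_withDensityᵥ hg, hν]
  have hone : (fun ω => ‖g ω‖ₑ) =ᵐ[ν.variation] 1 :=
    (withDensity_eq_iff_of_sigmaFinite hg.aestronglyMeasurable.enorm aemeasurable_one).1 hdens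
  refine ⟨g, hg, hone.mono fun ω hω => ?_, hν⟩
  simpa only [toReal_enorm, Pi.one_apply, ENNReal.toReal_one] using congrArg ENNReal.toReal hω

end Polar

theorem IsNonatomic.isNonatomicMeasure_variation {V : Type*} [NormedAddCommGroup V]
    {ν : VectorMeasure Ω V} (hν : IsNonatomic ν) : IsNonatomicMeasure ν.variation := by
  intro A hA hνA
  by_contra! hsplit
  rw [Ne, VectorMeasure.variation_apply_eq_zero hA] at hνA
  push Not at hνA
  obtain ⟨B, hBA, hB, hνB⟩ := hνA
  have hnull : ∀ {D}, MeasurableSet D → ν.variation D = 0 → ν D = 0 := fun hD h =>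
    (VectorMeasure.variation_apply_eq_zero hD).1 h _ Subset.rfl hD
  refine hν B ⟨hB, hνB, fun D hDB hD => (eq_or_ne (ν.variation D) 0).imp (hnull hD) fun hD0 => ?_⟩
  have hdiff : ν (B \ D) = 0 := hnull (hB.diff hD) <|
    measure_mono_null (sdiff_subset_sdiff_left hBA) (hsplit D (hDB.trans hBA) hD hD0)
  rw [← VectorMeasure.of_add_of_sdiff hD hB hDB, hdiff, add_zero]

theorem IsNonatomic.mapRange {F G : Type*} [AddCommGroup F] [TopologicalSpace F] [AddCommGroup G]
    [TopologicalSpace G] {ν : VectorMeasure Ω F} (hν : IsNonatomic ν) {L : F →+ G}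
    (hL : Continuous L) (hinj : Function.Injective L) : IsNonatomic (ν.mapRange L hL) := by
  rintro A ⟨hA, hνA, hsub⟩
  refine hν A ⟨hA, fun h => hνA (by rw [VectorMeasure.mapRange_apply, h, map_zero]),
    fun B hBA hB => (hsub B hBA hB).imp (fun h => ?_) fun h => hinj h⟩
  exact hinj (h.trans (map_zero L).symm)

theorem vectorMeasureRange_mapRange {F G : Type*} [AddCommGroup F] [TopologicalSpace F]
    [AddCommGroup G] [TopologicalSpace G] (ν : VectorMeasure Ω F) {L : F →+ G}
    (hL : Continuous L) : vectorMeasureRange (ν.mapRange L hL) = L '' vectorMeasureRange ν := by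
  ext y
  constructor
  · rintro ⟨A, hA, rfl⟩
    exact ⟨_, ⟨A, hA, rfl⟩, rfl⟩
  · rintro ⟨_, ⟨A, hA, rfl⟩, rfl⟩
    exact ⟨A, hA, rfl⟩

variable {V : Type*} [NormedAddCommGroup V] [NormedSpace ℝ V] {g : Ω → V}

theorem lpPairing_lsmul_toLp [CompleteSpace V] {f : Ω → ℝ} (hf : MemLp f 2 μ) (hg : MemLp g 2 μ) :
    (ContinuousLinearMap.lsmul ℝ ℝ).lpPairing μ 2 2 hf.toLp hg.toLp = ∫ ω, f ω • g ω ∂μ := by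
  rw [ContinuousLinearMap.lpPairing_eq_integral]
  refine integral_congr_ae ?_
  filter_upwards [hf.coeFn_toLp, hg.coeFn_toLp] with ω hf hg
  rw [hf, hg, ContinuousLinearMap.lsmul_apply]

theorem integral_indicator_one_smul {A : Set Ω} (hA : MeasurableSet A) :
    ∫ ω, A.indicator (fun _ => (1 : ℝ)) ω • g ω ∂μ = ∫ ω in A, g ω ∂μ := by
  rw [← integral_indicator hA]
  congr 1 with ω
  by_cases hω : ω ∈ A <;> simp [hω]

theorem IsNonatomicMeasure.vectorMeasureRange_withDensityᵥ [IsFiniteMeasure μ]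
    [FiniteDimensional ℝ V] (hμ : IsNonatomicMeasure μ) (hg : MemLp g 2 μ) :
    vectorMeasureRange (μ.withDensityᵥ g) =
      aumannIntegral μ (fun ω => (ContinuousLinearMap.lsmul ℝ ℝ).flip (g ω)) (Icc (0 : ℝ) 1) := by
  have hint : Integrable g μ := hg.integrable one_le_two
  ext y
  constructor
  · rintro ⟨A, hA, rfl⟩
    refine ⟨A.indicator fun _ => 1, ⟨aestronglyMeasurable_const.indicator hA,
      .of_forall fun ω => ?_⟩, ?_⟩
    · exact ⟨indicator_nonneg (fun _ _ => zero_le_one) ω,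
        indicator_le_self' (fun _ _ => zero_le_one) ω⟩
    · rw [withDensityᵥ_apply hint hA]
      exact integral_indicator_one_smul hA
  · rintro ⟨f, ⟨hfm, hf⟩, rfl⟩
    have hf2 : MemLp f 2 μ := memLp_of_bounded hf hfm 2
    obtain ⟨B, hB, hΦ⟩ := hμ.exists_map_indicatorConstLp_eq
      (((ContinuousLinearMap.lsmul ℝ ℝ).lpPairing μ 2 2).flip hg.toLp)
      ((toLp_mem_lpInto hf2).2 hf)
    refine ⟨B, hB, ?_⟩
    simp only [ContinuousLinearMap.flip_apply, indicatorConstLp, lpPairing_lsmul_toLp,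
      integral_indicator_one_smul hB] at hΦ
    rw [withDensityᵥ_apply hint hB, hΦ]
    rfl

theorem IsNonatomic.locallyNonconical_range_pi {ι : Type*} [Finite ι]
    {ν : VectorMeasure Ω (ι → ℝ)} (hν : IsNonatomic ν) :
    LocallyNonconical (vectorMeasureRange ν) := by
  have := Fintype.ofFinite ι
  obtain ⟨g, hg, hg1, hdens⟩ := exists_norm_eq_one_withDensityᵥ_variation_eq ν
  have := isFiniteMeasure_variation_pi ν
  have hg2 : MemLp g 2 ν.variation := .of_bound hg.aestronglyMeasurable 1 (hg1.mono fun _ => Eq.le)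
  have hrange := hν.isNonatomicMeasure_variation.vectorMeasureRange_withDensityᵥ hg2
  rw [hdens] at hrange
  rw [hrange]
  have hG := (ContinuousLinearMap.lsmul ℝ ℝ).flip.integrable_comp hg
  exact locallyNonconical_aumannIntegral isCompact_Icc (strictConvex_Icc 0 1) hG

theorem IsNonatomic.locallyNonconical_range {F : Type*} [AddCommGroup F] [Module ℝ F]
    [TopologicalSpace F] [IsTopologicalAddGroup F] [ContinuousSMul ℝ F] [T2Space F]
    [FiniteDimensional ℝ F] {ν : VectorMeasure Ω F} (hν : IsNonatomic ν) :
    LocallyNonconical (vectorMeasureRange ν) := by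
  let e := (Module.finBasis ℝ F).equivFunL
  let L : F →+ (Fin (Module.finrank ℝ F) → ℝ) := e.toLinearEquiv.toAddEquiv.toAddMonoidHom
  have hL : Continuous L := e.continuous
  refine .of_image (p := ⊤) (subset_univ _) e.toContinuousLinearMap e.injective.injOn ?_
  have hrange := (hν.mapRange hL e.injective).locallyNonconical_range_pi
  rwa [vectorMeasureRange_mapRange] at hrange

end VectorMeasure

section WeakStar

variable {Ω : Type*} [MeasurableSpace Ω] {μ : Measure Ω} {n : ℕ}

theorem exists_eq_integral_inner_of_continuous_weakStarTopology
    {φ : Lp (EuclideanSpace ℝ (Fin n)) ∞ μ →ₗ[ℝ] ℝ}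
    (hφ : Continuous[weakStarTopology μ n, inferInstance] φ) :
    ∃ g : Lp (EuclideanSpace ℝ (Fin n)) 1 μ, ∀ f, φ f = ∫ ω, inner ℝ (g ω) (f ω) ∂μ := by
  let B : Lp (EuclideanSpace ℝ (Fin n)) 1 μ →ₗ[ℝ] Lp (EuclideanSpace ℝ (Fin n)) ∞ μ →ₗ[ℝ] ℝ :=
    ContinuousLinearMap.coeLM ℝ ∘ₗ ((innerSL ℝ).lpPairing μ 1 ∞).toLinearMap
  have hB : ∀ g f, B g f = ∫ ω, inner ℝ (g ω) (f ω) ∂μ :=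
    (innerSL ℝ).lpPairing_eq_integral
  have htop : weakStarTopology μ n = ⨅ g, TopologicalSpace.induced (B g) inferInstance := by
    simp only [weakStarTopology, ← hB]
  rw [htop, ← LinearMap.mem_span_iff_continuous, ← LinearMap.coe_range, Submodule.span_eq] at hφ
  obtain ⟨g, rfl⟩ := hφ
  exact ⟨g, hB g⟩

variable {V : Type*} [NormedAddCommGroup V] [NormedSpace ℝ V]
  {T : Lp (EuclideanSpace ℝ (Fin n)) ∞ μ →ₗ[ℝ] V}

theorem exists_eq_integral_apply_of_continuous_weakStarTopology
    [FiniteDimensional ℝ V] (hT : Continuous[weakStarTopology μ n, inferInstance] T) :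
    ∃ G : Ω → EuclideanSpace ℝ (Fin n) →L[ℝ] V, Integrable G μ ∧
      ∀ f, T f = ∫ ω, G ω (f ω) ∂μ := by
  let b := Module.finBasis ℝ V
  have hcoord : ∀ i, ∃ g : Lp (EuclideanSpace ℝ (Fin n)) 1 μ,
      ∀ f, b.repr (T f) i = ∫ ω, inner ℝ (g ω) (f ω) ∂μ := fun i => by
    have hcont : Continuous (b.coord i) := (b.coord i).continuous_of_finiteDimensional
    exact exists_eq_integral_inner_of_continuous_weakStarTopology (φ := b.coord i ∘ₗ T)
      (@Continuous.comp _ _ _ (weakStarTopology μ n) _ _ T (b.coord i) hcont hT)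
  choose g hg using hcoord
  have hG : ∀ i, Integrable (fun ω => (innerSL ℝ (g i ω)).smulRight (b i)) μ := fun i =>
    let L := (ContinuousLinearMap.smulRightL ℝ (EuclideanSpace ℝ (Fin n)) V).flip (b i)
    (L ∘L innerSL ℝ).integrable_comp (L1.integrable_coeFn (g i))
  have hinner : ∀ i (f : Lp (EuclideanSpace ℝ (Fin n)) ∞ μ),
      Integrable (fun ω => inner ℝ (g i ω) (f ω)) μ := fun i f =>
    memLp_one_iff_integrable.1 ((innerSL ℝ).memLp_of_bilin 1 (Lp.memLp (g i)) (Lp.memLp f))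
  refine ⟨fun ω => ∑ i, (innerSL ℝ (g i ω)).smulRight (b i),
    integrable_finsetSum (ε' := EuclideanSpace ℝ (Fin n) →L[ℝ] V) _ fun i _ => hG i, fun f => ?_⟩
  calc T f = ∑ i, b.repr (T f) i • b i := (b.sum_repr (T f)).symm
    _ = ∑ i, ∫ ω, inner ℝ (g i ω) (f ω) • b i ∂μ := by simp only [hg, integral_smul_const]
    _ = ∫ ω, ∑ i, inner ℝ (g i ω) (f ω) • b i ∂μ :=
      (integral_finsetSum _ fun i _ => (hinner i f).smul_const _).symm
    _ = _ := by
      simp only [sum_apply, ContinuousLinearMap.smulRight_apply, innerSL_apply_apply]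

theorem image_LinftyInto_eq_aumannIntegral {K : Set (EuclideanSpace ℝ (Fin n))}
    (hK : Bornology.IsBounded K) {G : Ω → EuclideanSpace ℝ (Fin n) →L[ℝ] V}
    (hT : ∀ f, T f = ∫ ω, G ω (f ω) ∂μ) : T '' LinftyInto μ K = aumannIntegral μ G K := by
  ext y
  constructor
  · rintro ⟨f, hf, rfl⟩
    exact ⟨f, ⟨Lp.aestronglyMeasurable f, hf⟩, (hT f).symm⟩
  · rintro ⟨f, ⟨hfm, hf⟩, rfl⟩
    obtain ⟨R, hR⟩ := hK.exists_norm_le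
    have hf' : MemLp f ∞ μ := memLp_top_of_bound hfm R (hf.mono fun ω hω => hR _ hω)
    refine ⟨hf'.toLp, (toLp_mem_lpInto hf').2 hf, (hT _).trans (integral_congr_ae ?_)⟩
    filter_upwards [hf'.coeFn_toLp] with ω hω
    rw [hω]

theorem locallyNonconical_image_LinftyInto {F : Type*} [AddCommGroup F] [Module ℝ F]
    [TopologicalSpace F] [IsTopologicalAddGroup F] [ContinuousSMul ℝ F] [T2Space F]
    [FiniteDimensional ℝ F] {K : Set (EuclideanSpace ℝ (Fin n))} (hc : IsCompact K)
    (hK : StrictConvex ℝ K) {T : Lp (EuclideanSpace ℝ (Fin n)) ∞ μ →ₗ[ℝ] F}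
    (hT : Continuous[weakStarTopology μ n, inferInstance] T) :
    LocallyNonconical (T '' LinftyInto μ K) := by
  let e := (Module.finBasis ℝ F).equivFunL
  have heT : Continuous[weakStarTopology μ n, inferInstance] (e.toLinearEquiv.toLinearMap ∘ₗ T) :=
    @Continuous.comp _ _ _ (weakStarTopology μ n) _ _ T e e.continuous hT
  obtain ⟨G, hG, hGT⟩ := exists_eq_integral_apply_of_continuous_weakStarTopology heT
  refine .of_image (p := ⊤) (subset_univ _) e.toContinuousLinearMap e.injective.injOn ?_
  have himage : e '' (T '' LinftyInto μ K) = aumannIntegral μ G K :=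
    (image_image _ _ _).trans (image_LinftyInto_eq_aumannIntegral hc.isBounded hGT)
  exact himage ▸ locallyNonconical_aumannIntegral hc hK hG

end WeakStar

theorem corollary34_general {F : Type*} [AddCommGroup F] [Module ℝ F] [TopologicalSpace F]
    [IsTopologicalAddGroup F] [ContinuousSMul ℝ F] [T2Space F] [FiniteDimensional ℝ F] :
    (∀ {Ω : Type*} [MeasurableSpace Ω] (ν : VectorMeasure Ω F),
      IsNonatomic ν → LocallyNonconical (vectorMeasureRange ν)) ∧
    (∀ {Ω : Type*} [MeasurableSpace Ω] (μ : Measure Ω) (n : ℕ)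
      (K : Set (EuclideanSpace ℝ (Fin n))), IsCompact K → StrictConvex ℝ K →
      ∀ T : Lp (EuclideanSpace ℝ (Fin n)) ∞ μ →ₗ[ℝ] F,
        Continuous[weakStarTopology μ n, inferInstance] T →
        LocallyNonconical (T '' LinftyInto μ K)) :=
  ⟨fun _ hν => hν.locallyNonconical_range,
    fun _ _ _ hc hK _ hT => locallyNonconical_image_LinftyInto hc hK hT⟩

theorem corollary34 {F : Type*} [AddCommGroup F] [Module ℝ F] [TopologicalSpace F]
    [IsTopologicalAddGroup F] [ContinuousSMul ℝ F] [T2Space F] [FiniteDimensional ℝ F] :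
    (∀ {Ω : Type*} [MeasurableSpace Ω] (ν : VectorMeasure Ω F),
      IsNonatomic ν → LocallyNonconical (vectorMeasureRange ν)) ∧
    (∀ {Ω : Type*} [MeasurableSpace Ω] (μ : Measure Ω) [SigmaFinite μ] (n : ℕ)
      (K : Set (EuclideanSpace ℝ (Fin n))), IsCompact K → StrictConvex ℝ K →
      ∀ T : Lp (EuclideanSpace ℝ (Fin n)) ∞ μ →ₗ[ℝ] F,
        Continuous[weakStarTopology μ n, inferInstance] T →
        LocallyNonconical (T '' LinftyInto μ K)) :=
  corollary34_general.imp_right fun h _ _ μ _ n K => h μ n K
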